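/- Fix $T>0$ and let $X$ be the set of sequences $a=(a_1,a_2,\dots)$ of bounded measurable functions $a_i:[0,T]\to\mathbb C$ with $\sup_{x\in[0,T],\,i\ge 1}|a_i(x)|^{1/i}<\infty$. For $a,b\in X$ let $a*b\in X$ be given by $(a*b)_i(x)=2b_i(2x)$ for $0\le x\le T/2$ and $(a*b)_i(x)=2a_i(2x-T)$ for $T/2<x\le T$, and let $a^{-1}\in X$ be given by $(a^{-1})_i(x)=-a_i(T-x)$. For $k\ge 1$ and $i_1,\dots,i_k\in\{1,2,\dots\}$ the basic iterated integral of order $k$ is $$I_{i_1,\dots,i_k}(a)=\int\!\cdots\!\int_{0\le s_1\le\cdots\le s_k\le T}a_{i_k}(s_k)\cdots a_{i_1}(s_1)\,ds_k\cdots ds_1 .$$ Write $a\sim b$ if all basic iterated integrals vanish at $a*b^{-1}$. This is an equivalence relation, and $G(X)=X/\!\sim$ is a group with the product induced by $*$; the integrals induce functions $\widehat I_{i_1,\dots,i_k}$ on $G(X)$. Equip $G(X)$ with the metric $$d(g,h)=\sum_{n=1}^{\infty}\frac1{4^n}\sum_{i_1+\cdots+i_k=n}\frac{|\widehat I_{i_1,\dots,i_k}(g)-\widehat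 I_{i_1,\dots,i_k}(h)|}{1+|\widehat I_{i_1,\dots,i_k}(g)-\widehat I_{i_1,\dots,i_k}(h)|}.$$ Then $G(X)$ is a topological group. Let $G_f(X)\supset G(X)$ be its completion with respect to $d$, a topological group whose operations extend those of $G(X)$ by continuity, and extend the functions $\widehat I_{i_1,\dots,i_k}$ to $G_f(X)$ by continuity. For a topological group $H$ put $H_1=[H,H]$ and $H_n=[H,H_{n-1}]$ for $n\ge 2$, and let $\overline{H}_n$ be the closure of $H_n$ in $H$ (the $n$-th term of the topological lower central series of $H$). Theorem. Let $n\ge 1$. (1) An element $g\in G_f(X)$ belongs to $\overline{G_f(X)}_n$ if and only if $\widehat I_{i_1,\dots,i_k}(g)=0$ for all $1\le k\le n$ and all $i_1,\dots,i_k\ge 1$. (2) $\overline{G(X)}_n=\overline{G_f(X)}_n\cap G(X)$, where the closure on the left is taken in $G(X)$. -/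

import Mathlib

noncomputable section

namespace FormalPaths

/-! ### Noncommutative formal power series with constant term one -/

/-- A word `[i₁, …, i_k]` in the letters `1, 2, 3, …`, that is, a multi-index of positive integers.
Its length `k` is the order of the corresponding basic iterated integral. -/
abbrev Word : Type := List ℕ+

/-- The weight `i₁ + ⋯ + i_k` of a word. -/
def weight (w : Word) : ℕ := (w.map fun i : ℕ+ => (i : ℕ)).sum

/-- The concatenation product of two functions on words:
`(f ⋆ g)(w) = ∑ f(u) g(v)` over all the ways to write `w = u v`. -/
def conv (f g : Word → ℂ) (w : Word) : ℂ :=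
  ∑ j ∈ Finset.range (w.length + 1), f (w.take j) * g (w.drop j)

theorem conv_nil (f g : Word → ℂ) : conv f g [] = f [] * g [] := by
  simp [conv]

theorem conv_cons (f g : Word → ℂ) (i : ℕ+) (w : Word) :
    conv f g (i :: w) = f [] * g (i :: w) + conv (fun u => f (i :: u)) g w := by
  simp only [conv, List.length_cons]
  rw [Finset.sum_range_succ']
  simp [add_comm]

theorem conv_add_left (f₁ f₂ g : Word → ℂ) (w : Word) :
    conv (fun u => f₁ u + f₂ u) g w = conv f₁ g w + conv f₂ g w := by
  simp [conv, add_mul, Finset.sum_add_distrib]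

theorem conv_const_mul_left (c : ℂ) (f g : Word → ℂ) (w : Word) :
    conv (fun u => c * f u) g w = c * conv f g w := by
  simp [conv, Finset.mul_sum, mul_assoc]

theorem conv_assoc (f g h : Word → ℂ) (w : Word) :
    conv (conv f g) h w = conv f (conv g h) w := by
  induction w generalizing f g with
  | nil => simp [conv_nil, mul_assoc]
  | cons i w ih =>
    rw [conv_cons, conv_cons]
    have : (fun u => conv f g (i :: u)) =
        fun u => f [] * (fun u => g (i :: u)) u + conv (fun u => f (i :: u)) g u := by
      funext u; rw [conv_cons]
    rw [this, conv_add_left, conv_const_mul_left, ih, conv_nil, conv_cons]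
    ring

/-- The convolution unit. -/
def unitSeries : Word → ℂ
  | [] => 1
  | _ :: _ => 0

theorem conv_zero_left (g : Word → ℂ) (w : Word) : conv (fun _ => 0) g w = 0 := by
  simp [conv]

theorem unitSeries_conv (f : Word → ℂ) (w : Word) : conv unitSeries f w = f w := by
  cases w with
  | nil => simp [conv_nil, unitSeries]
  | cons i w => rw [conv_cons]; simp [unitSeries, conv_zero_left]

theorem conv_unitSeries (f : Word → ℂ) (w : Word) : conv f unitSeries w = f w := by
  induction w generalizing f with
  | nil => simp [conv_nil, unitSeries]
  | cons i w ih => rw [conv_cons, ih]; simp [unitSeries]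

/-- The convolution inverse of a series with constant term one. -/
def convInv (f : Word → ℂ) : Word → ℂ
  | [] => 1
  | i :: w => -∑ j : Fin (w.length + 1), f (i :: w.take j) * convInv f (w.drop j)
termination_by w => w.length
decreasing_by simp [List.length_drop]

theorem convInv_nil (f : Word → ℂ) : convInv f [] = 1 := convInv.eq_1 f

theorem convInv_cons (f : Word → ℂ) (i : ℕ+) (w : Word) :
    convInv f (i :: w) = -conv (fun u => f (i :: u)) (convInv f) w := by
  rw [convInv.eq_2, conv, Finset.sum_range]

theorem conv_convInv (f : Word → ℂ) (hf : f [] = 1) (w : Word) :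
    conv f (convInv f) w = unitSeries w := by
  cases w with
  | nil => simp [conv_nil, hf, convInv_nil, unitSeries]
  | cons i w => rw [conv_cons, hf, convInv_cons]; simp [unitSeries]

theorem continuous_convInv (w : Word) : Continuous fun f : Word → ℂ => convInv f w := by
  induction h : w.length using Nat.strong_induction_on generalizing w with
  | _ n ih =>
    cases w with
    | nil => simp only [convInv_nil]; exact continuous_const
    | cons i w =>
      simp only [convInv_cons, conv]
      refine (continuous_finsetSum _ fun j _ =>
        (continuous_apply (A := fun _ : Word => ℂ) (i :: w.take j)).mul ?_).neg
      exact ih (w.drop j).length (by simp at h ⊢; omega) _ rfl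

/-- The group of noncommutative formal power series
`1 + ∑ c_{i₁,…,i_k} X_{i_k} ⋯ X_{i₁} t^{i₁ + ⋯ + i_k}` with complex coefficients and constant term
one, a series being given by its coefficients. The power of `t` is determined by the monomial. Note
that a word lists the letters of its monomial from right to left, the order in which the basic
iterated integrals occur in the solution of `F' = (∑ aᵢ tⁱ Xᵢ) F`. -/
def SeriesGroup : Type := {f : Word → ℂ // f [] = 1}

namespace SeriesGroup

/-- The topology and the uniform structure of coefficientwise convergence. -/
instance : UniformSpace SeriesGroup := inferInstanceAs (UniformSpace {f : Word → ℂ // f [] = 1})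

instance : T2Space SeriesGroup := inferInstanceAs (T2Space {f : Word → ℂ // f [] = 1})

instance : CompleteSpace SeriesGroup :=
  (isClosed_eq (continuous_apply ([] : Word)) continuous_const :
    IsClosed {f : Word → ℂ | f [] = 1}).completeSpace_coe

/-- The product of power series; see `SeriesGroup` for the order of the letters. -/
instance : Mul SeriesGroup :=
  ⟨fun f g => ⟨conv g.1 f.1, by rw [conv_nil, f.2, g.2, one_mul]⟩⟩

instance : One SeriesGroup := ⟨⟨unitSeries, rfl⟩⟩

instance : Inv SeriesGroup := ⟨fun f => ⟨convInv f.1, convInv_nil _⟩⟩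

instance : Group SeriesGroup :=
  Group.ofLeftAxioms
    (fun f g h => Subtype.ext (funext fun w => (conv_assoc h.1 g.1 f.1 w).symm))
    (fun f => Subtype.ext (funext fun w => conv_unitSeries f.1 w))
    (fun f => Subtype.ext (funext fun w => conv_convInv f.1 f.2 w))

instance : IsTopologicalGroup SeriesGroup where
  continuous_mul := by
    refine Continuous.subtype_mk (continuous_pi fun w => ?_) _
    refine continuous_finsetSum _ fun j _ => ?_
    exact ((continuous_apply _).comp (continuous_subtype_val.comp continuous_snd)).mul
      ((continuous_apply _).comp (continuous_subtype_val.comp continuous_fst))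
  continuous_inv := by
    refine Continuous.subtype_mk (continuous_pi fun w => ?_) _
    exact (continuous_convInv w).comp continuous_subtype_val

end SeriesGroup

/-! ### The semigroup of coefficients -/

/-- The set `X` of sequences `a = (a₁, a₂, …)` of bounded measurable complex-valued functions on
`[0, T]` such that `sup |aᵢ(x)|^{1/i} < ∞` over all `i` and `x`. Functions on `[0, T]` are written as
functions on `ℝ` that vanish outside `[0, T]`. -/
@[ext] structure PathSpace (T : ℝ) where
  /-- the functions `aᵢ` -/
  coeff : ℕ+ → ℝ → ℂ
  measurable : ∀ i, Measurable (coeff i)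
  eq_zero : ∀ i x, x ∉ Set.Icc 0 T → coeff i x = 0
  bounded : ∃ C : ℝ, ∀ i x, ‖coeff i x‖ ≤ C ^ (i : ℕ)

variable {T : ℝ}

namespace PathSpace

/-- The product `a * b`: first `b` on `[0, T/2]`, then `a` on `(T/2, T]`, at double speed. -/
instance [hT : Fact (0 < T)] : Mul (PathSpace T) where
  mul a b :=
    { coeff := fun i x => if x ≤ T / 2 then 2 * b.coeff i (2 * x) else 2 * a.coeff i (2 * x - T)
      measurable := fun i => by
        refine Measurable.ite measurableSet_Iic ?_ ?_
        · exact ((b.measurable i).comp (measurable_id.const_mul 2)).const_mul 2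
        · exact ((a.measurable i).comp ((measurable_id.const_mul 2).sub_const T)).const_mul 2
      eq_zero := fun i x hx => by
        have := hT.out
        simp only [Set.mem_Icc, not_and_or, not_le] at hx
        split_ifs with h
        · rw [b.eq_zero, mul_zero]
          rintro ⟨h1, h2⟩
          rcases hx with hx | hx <;> linarith
        · rw [a.eq_zero, mul_zero]
          rintro ⟨h1, h2⟩
          rcases hx with hx | hx <;> linarith
      bounded := by
        obtain ⟨A, hA⟩ := a.bounded
        obtain ⟨B, hB⟩ := b.bounded
        have hA0 : 0 ≤ A := by simpa using (norm_nonneg _).trans (hA 1 0)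
        have hB0 : 0 ≤ B := by simpa using (norm_nonneg _).trans (hB 1 0)
        refine ⟨2 * (A + B), fun i x => ?_⟩
        have h2 : (2 : ℝ) ≤ 2 ^ (i : ℕ) := le_self_pow₀ (by norm_num) i.pos.ne'
        rw [mul_pow]
        split_ifs
        · rw [norm_mul, Complex.norm_ofNat]
          gcongr
          exact (hB i _).trans (by gcongr; linarith)
        · rw [norm_mul, Complex.norm_ofNat]
          gcongr
          exact (hA i _).trans (by gcongr; linarith) }

/-- The reversed path `a⁻¹(x) = -a(T - x)`. -/
instance : Inv (PathSpace T) where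
  inv a :=
    { coeff := fun i x => -a.coeff i (T - x)
      measurable := fun i => ((a.measurable i).comp (measurable_id.const_sub T)).neg
      eq_zero := fun i x hx => by
        rw [a.eq_zero, neg_zero]
        rintro ⟨h1, h2⟩
        exact hx ⟨by linarith, by linarith⟩
      bounded := by
        obtain ⟨A, hA⟩ := a.bounded
        exact ⟨A, fun i x => by simpa using hA i (T - x)⟩ }

/-- The zero sequence, which represents the constant path. -/
instance : Zero (PathSpace T) where
  zero :=
    { coeff := fun _ _ => 0
      measurable := fun _ => measurable_const
      eq_zero := fun _ _ _ => rfl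
      bounded := ⟨0, fun i _ => by simp⟩ }

/-- The iterated integral
`∫_{x ≤ s₁ ≤ ⋯ ≤ s_k ≤ T} a_{i_k}(s_k) ⋯ a_{i₁}(s₁) ds_k ⋯ ds₁`, where the outer variable `s₁` runs
over `[x, T]`, the next one `s₂` over `[s₁, T]`, and so on. -/
def integralFrom (a : PathSpace T) : Word → ℝ → ℂ
  | [], _ => 1
  | i :: w, x => ∫ s in x..T, a.coeff i s * integralFrom a w s

/-- The basic iterated integral
`I_{i₁,…,i_k}(a) = ∫_{0 ≤ s₁ ≤ ⋯ ≤ s_k ≤ T} a_{i_k}(s_k) ⋯ a_{i₁}(s₁) ds_k ⋯ ds₁`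
(equal to `1` for `k = 0`). -/
def iterInt (a : PathSpace T) (w : Word) : ℂ := integralFrom a w 0

theorem intervalIntegrable_mul (a : PathSpace T) (i : ℕ+) {f : ℝ → ℂ} (hf : Continuous f)
    (x y : ℝ) : IntervalIntegrable (fun s => a.coeff i s * f s) MeasureTheory.volume x y := by
  obtain ⟨A, hA⟩ := a.bounded
  have h1 : IntervalIntegrable f MeasureTheory.volume x y := hf.intervalIntegrable x y
  rw [intervalIntegrable_iff] at h1 ⊢
  exact h1.bdd_mul (c := A ^ (i : ℕ)) (a.measurable i).aestronglyMeasurable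
    (Filter.Eventually.of_forall fun s => hA i s)

theorem continuous_integralFrom (a : PathSpace T) (w : Word) : Continuous (integralFrom a w) := by
  induction w with
  | nil => exact continuous_const
  | cons i w ih =>
    have : integralFrom a (i :: w) =
        fun x => -∫ s in T..x, a.coeff i s * integralFrom a w s := by
      funext x
      rw [integralFrom, intervalIntegral.integral_symm]
    rw [this]
    exact (intervalIntegral.continuous_primitive
      (fun x y => intervalIntegrable_mul a i ih x y) T).neg

theorem integral_coeff (a : PathSpace T) (i : ℕ+) (w : Word) (x y : ℝ) :
    ∫ s in x..y, a.coeff i s * integralFrom a w s =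
      integralFrom a (i :: w) x - integralFrom a (i :: w) y := by
  rw [integralFrom, integralFrom, eq_sub_iff_add_eq]
  exact intervalIntegral.integral_add_adjacent_intervals
    (intervalIntegrable_mul a i (continuous_integralFrom a w) _ _)
    (intervalIntegrable_mul a i (continuous_integralFrom a w) _ _)

theorem integralFrom_end (a : PathSpace T) (i : ℕ+) (w : Word) :
    integralFrom a (i :: w) T = 0 := by
  simp [integralFrom]

theorem iterInt_nil (a : PathSpace T) : a.iterInt [] = 1 := rfl

section Product

variable [hT : Fact (0 < T)]

theorem mul_coeff (a b : PathSpace T) (i : ℕ+) (x : ℝ) : (a * b).coeff i x =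
    if x ≤ T / 2 then 2 * b.coeff i (2 * x) else 2 * a.coeff i (2 * x - T) := rfl

theorem integralFrom_mul_right (a b : PathSpace T) (w : Word) (x : ℝ) (hx : T / 2 ≤ x) :
    integralFrom (a * b) w x = integralFrom a w (2 * x - T) := by
  induction w generalizing x with
  | nil => rfl
  | cons i w ih =>
    rw [integralFrom, integralFrom]
    have h0 := hT.out
    have h1 : ∫ s in x..T, (a * b).coeff i s * integralFrom (a * b) w s =
        ∫ s in x..T, (2 : ℝ) • (a.coeff i (2 * s - T) * integralFrom a w (2 * s - T)) := by
      refine intervalIntegral.integral_congr_ae (Filter.Eventually.of_forall fun s hs => ?_)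
      have hs2 : T / 2 < s ∨ s ≤ T / 2 := lt_or_ge _ _
      by_cases hxT : x ≤ T
      · rw [Set.uIoc_of_le hxT] at hs
        rw [mul_coeff, if_neg (by linarith [hs.1]), ih s (by linarith [hs.1])]
        simp [mul_assoc]
      · rw [Set.uIoc_of_ge (by linarith)] at hs
        rw [mul_coeff, if_neg (by linarith [hs.1]), ih s (by linarith [hs.1])]
        simp [mul_assoc]
    rw [h1, intervalIntegral.integral_smul,
      intervalIntegral.smul_integral_comp_mul_sub
        (f := fun s => a.coeff i s * integralFrom a w s) (c := 2) (d := T)]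
    congr 1
    ring

theorem integralFrom_mul_left (a b : PathSpace T) (w : Word) (x : ℝ) (hx : x ≤ T / 2) :
    integralFrom (a * b) w x =
      conv (fun u => integralFrom b u (2 * x)) a.iterInt w := by
  induction w generalizing x with
  | nil => simp [conv_nil, iterInt_nil, integralFrom]
  | cons i w ih =>
    have h0 := hT.out
    have h1 : ∫ s in x..(T / 2), (a * b).coeff i s * integralFrom (a * b) w s =
        ∫ s in x..(T / 2), ∑ j ∈ Finset.range (w.length + 1),
          ((2 : ℝ) • (b.coeff i (2 * s) * integralFrom b (w.take j) (2 * s))) *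
            a.iterInt (w.drop j) := by
      refine intervalIntegral.integral_congr fun s hs => ?_
      rw [Set.uIcc_of_le hx] at hs
      rw [mul_coeff, if_pos hs.2, ih s hs.2, conv, Finset.mul_sum]
      refine Finset.sum_congr rfl fun j _ => ?_
      simp only [Complex.real_smul]
      push_cast
      ring
    have hint : ∀ j : ℕ, IntervalIntegrable
        (fun s => b.coeff i (2 * s) * integralFrom b (w.take j) (2 * s))
        MeasureTheory.volume x (T / 2) := by
      intro j
      obtain ⟨B, hB⟩ := b.bounded
      have h1 : IntervalIntegrable (fun s => integralFrom b (w.take j) (2 * s))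
          MeasureTheory.volume x (T / 2) :=
        ((continuous_integralFrom b (w.take j)).comp
          (continuous_const.mul continuous_id)).intervalIntegrable _ _
      rw [intervalIntegrable_iff] at h1 ⊢
      exact h1.bdd_mul (c := B ^ (i : ℕ))
        ((b.measurable i).comp (measurable_id.const_mul 2)).aestronglyMeasurable
        (Filter.Eventually.of_forall fun s => hB i _)
    rw [← sub_add_cancel (integralFrom (a * b) (i :: w) x)
      (integralFrom (a * b) (i :: w) (T / 2)), ← integral_coeff, h1,
      intervalIntegral.integral_finsetSum
        (f := fun j s => ((2 : ℝ) • (b.coeff i (2 * s) * integralFrom b (w.take j) (2 * s))) *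
          a.iterInt (w.drop j))
        (fun j _ => ((hint j).smul (2 : ℝ)).mul_const _), conv_cons,
      integralFrom_mul_right a b _ _ le_rfl]
    have h2 : 2 * (T / 2) - T = 0 := by ring
    rw [h2, add_comm]
    have h3 : integralFrom b [] (2 * x) = 1 := rfl
    rw [h3, one_mul]
    congr 1
    rw [conv]
    refine Finset.sum_congr rfl fun j _ => ?_
    rw [intervalIntegral.integral_mul_const, intervalIntegral.integral_smul,
      intervalIntegral.smul_integral_comp_mul_left
        (f := fun s => b.coeff i s * integralFrom b (w.take j) s) (c := 2),
      integral_coeff, show 2 * (T / 2) = T by ring, integralFrom_end, sub_zero]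

theorem iterInt_mul (a b : PathSpace T) (w : Word) :
    (a * b).iterInt w = conv b.iterInt a.iterInt w := by
  have := hT.out
  rw [iterInt, integralFrom_mul_left a b w 0 (by linarith), mul_zero]
  rfl

end Product

theorem integralFrom_inv (a : PathSpace T) (w : Word) (x : ℝ) :
    integralFrom a⁻¹ w x =
      conv (fun u => integralFrom a u (T - x)) (convInv a.iterInt) w := by
  induction w generalizing x with
  | nil => simp [conv_nil, convInv_nil, integralFrom]
  | cons i w ih =>
    have h1 : ∀ s, (a⁻¹).coeff i s * integralFrom a⁻¹ w s =
        ∑ j ∈ Finset.range (w.length + 1),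
          (-(a.coeff i (T - s) * integralFrom a (w.take j) (T - s))) *
            convInv a.iterInt (w.drop j) := by
      intro s
      rw [ih, conv, Finset.mul_sum]
      refine Finset.sum_congr rfl fun j _ => ?_
      change -a.coeff i (T - s) * _ = _
      ring
    have hint : ∀ j : ℕ, IntervalIntegrable
        (fun s => a.coeff i (T - s) * integralFrom a (w.take j) (T - s))
        MeasureTheory.volume x T := by
      intro j
      obtain ⟨B, hB⟩ := a.bounded
      have h1 : IntervalIntegrable (fun s => integralFrom a (w.take j) (T - s))
          MeasureTheory.volume x T :=
        ((continuous_integralFrom a (w.take j)).comp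
          (continuous_const.sub continuous_id)).intervalIntegrable _ _
      rw [intervalIntegrable_iff] at h1 ⊢
      exact h1.bdd_mul (c := B ^ (i : ℕ))
        ((a.measurable i).comp (measurable_id.const_sub T)).aestronglyMeasurable
        (Filter.Eventually.of_forall fun s => hB i _)
    rw [integralFrom]
    simp_rw [h1]
    rw [intervalIntegral.integral_finsetSum
      (f := fun j s => (-(a.coeff i (T - s) * integralFrom a (w.take j) (T - s))) *
        convInv a.iterInt (w.drop j))
      (fun j _ => (hint j).neg.mul_const _), conv_cons,
      convInv_cons]
    have h3 : integralFrom a [] (T - x) = 1 := rfl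
    rw [h3, one_mul, conv, conv, neg_add_eq_sub, ← Finset.sum_sub_distrib]
    refine Finset.sum_congr rfl fun j _ => ?_
    rw [intervalIntegral.integral_mul_const, intervalIntegral.integral_neg,
      intervalIntegral.integral_comp_sub_left
        (fun s => a.coeff i s * integralFrom a (w.take j) s) T,
      integral_coeff, sub_self, ← sub_mul]
    congr 1
    simp [iterInt]

theorem iterInt_inv (a : PathSpace T) (w : Word) : (a⁻¹).iterInt w = convInv a.iterInt w := by
  rw [iterInt, integralFrom_inv, sub_zero]
  have : (fun u => integralFrom a u T) = unitSeries := by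
    funext u
    cases u with
    | nil => rfl
    | cons i u => exact integralFrom_end a i u
  rw [this, unitSeries_conv]

theorem iterInt_zero (w : Word) : (0 : PathSpace T).iterInt w = unitSeries w := by
  cases w with
  | nil => rfl
  | cons i w =>
    have : ∀ s, (0 : PathSpace T).coeff i s = 0 := fun _ => rfl
    simp [iterInt, integralFrom, unitSeries, this]

/-- The series `E(a)` whose coefficients are the basic iterated integrals of `a`. -/
def toSeries (a : PathSpace T) : SeriesGroup := ⟨a.iterInt, rfl⟩

theorem toSeries_inv (a : PathSpace T) : a⁻¹.toSeries = a.toSeries⁻¹ :=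
  Subtype.ext (funext (iterInt_inv a))

theorem toSeries_zero : (0 : PathSpace T).toSeries = 1 := Subtype.ext (funext iterInt_zero)

variable [hT : Fact (0 < T)]

theorem toSeries_mul (a b : PathSpace T) : (a * b).toSeries = a.toSeries * b.toSeries :=
  Subtype.ext (funext (iterInt_mul a b))

/-- `a ∼ b` if all basic iterated integrals (of positive order) vanish at `a * b⁻¹`. -/
def Equivalent (a b : PathSpace T) : Prop := ∀ w : Word, w ≠ [] → (a * b⁻¹).iterInt w = 0

theorem equivalent_iff {a b : PathSpace T} : Equivalent a b ↔ a.toSeries = b.toSeries := by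
  rw [← mul_inv_eq_one, ← toSeries_inv, ← toSeries_mul]
  constructor
  · intro h
    refine Subtype.ext (funext fun w => ?_)
    cases w with
    | nil => rfl
    | cons i w => exact h _ (by simp)
  · intro h w hw
    have := congrFun (congrArg Subtype.val h) w
    cases w with
    | nil => exact absurd rfl hw
    | cons i w => exact this

/-- The equivalence relation `∼` on `X`. -/
def setoid (T : ℝ) [Fact (0 < T)] : Setoid (PathSpace T) where
  r := Equivalent
  iseqv :=
    { refl := fun _ => equivalent_iff.2 rfl
      symm := fun h => equivalent_iff.2 (equivalent_iff.1 h).symm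
      trans := fun h h' => equivalent_iff.2 ((equivalent_iff.1 h).trans (equivalent_iff.1 h')) }

end PathSpace

/-! ### The group of paths -/

/-- The group of paths `G(X) = X / ∼`. -/
def PathGroup (T : ℝ) [Fact (0 < T)] : Type := Quotient (PathSpace.setoid T)

namespace PathGroup

variable [hT : Fact (0 < T)]

/-- The quotient map `π : X → G(X)`. -/
def mk (a : PathSpace T) : PathGroup T := Quotient.mk (PathSpace.setoid T) a

/-- The map `G(X) → SeriesGroup` induced by `E`. -/
def toSeries (g : PathGroup T) : SeriesGroup :=
  Quotient.lift PathSpace.toSeries (fun _ _ h => PathSpace.equivalent_iff.1 h) g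

theorem toSeries_injective : Function.Injective (toSeries : PathGroup T → SeriesGroup) := by
  rintro ⟨a⟩ ⟨b⟩ h
  exact Quotient.sound (s := PathSpace.setoid T) (PathSpace.equivalent_iff.2 h)

/-- The product on `G(X)` induced by the product of `X`. -/
instance : Mul (PathGroup T) :=
  ⟨Quotient.map₂ (· * ·) fun a a' h b b' h' => PathSpace.equivalent_iff.2 (by
    rw [PathSpace.toSeries_mul, PathSpace.toSeries_mul, PathSpace.equivalent_iff.1 h,
      PathSpace.equivalent_iff.1 h'])⟩

instance : One (PathGroup T) := ⟨mk 0⟩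

/-- The inverse on `G(X)` induced by the reversal of paths. -/
instance : Inv (PathGroup T) :=
  ⟨Quotient.map (·⁻¹) fun a a' h => PathSpace.equivalent_iff.2 (by
    rw [PathSpace.toSeries_inv, PathSpace.toSeries_inv, PathSpace.equivalent_iff.1 h])⟩

theorem toSeries_mul (g h : PathGroup T) : (g * h).toSeries = g.toSeries * h.toSeries := by
  induction g using Quotient.inductionOn
  induction h using Quotient.inductionOn
  exact PathSpace.toSeries_mul _ _

theorem toSeries_one : (1 : PathGroup T).toSeries = 1 := PathSpace.toSeries_zero

theorem toSeries_inv (g : PathGroup T) : (g⁻¹).toSeries = g.toSeries⁻¹ := by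
  induction g using Quotient.inductionOn
  exact PathSpace.toSeries_inv _

instance : Group (PathGroup T) :=
  Group.ofLeftAxioms
    (fun f g h => toSeries_injective (by simp only [toSeries_mul, mul_assoc]))
    (fun f => toSeries_injective (by simp only [toSeries_mul, toSeries_one, one_mul]))
    (fun f => toSeries_injective (by
      simp only [toSeries_mul, toSeries_one, toSeries_inv, inv_mul_cancel]))

/-- The basic iterated integral `Î_{i₁,…,i_k}` on `G(X)`, characterized by `I = Î ∘ π`. -/
def iterInt (w : Word) (g : PathGroup T) : ℂ := g.toSeries.1 w

theorem iterInt_mk (w : Word) (a : PathSpace T) : iterInt w (mk a) = a.iterInt w := rfl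

/-- The composition of the weight of a word given by its letters. -/
def toComposition (w : Word) : Composition (weight w) where
  blocks := w.map fun i : ℕ+ => (i : ℕ)
  blocks_pos := by
    intro i hi
    obtain ⟨j, -, rfl⟩ := List.mem_map.1 hi
    exact j.pos
  blocks_sum := rfl

theorem summable_composition :
    Summable fun p : (Σ n, Composition n) => ((1 : ℝ) / 4) ^ p.1 := by
  refine (summable_sigma_of_nonneg fun p => by positivity).2 ⟨fun n => Summable.of_finite, ?_⟩
  have h : ∀ n : ℕ, ∑' _ : Composition n, ((1 : ℝ) / 4) ^ n ≤ (1 / 2) ^ n := by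
    intro n
    rw [tsum_fintype, Finset.sum_const, Finset.card_univ, composition_card, nsmul_eq_mul]
    push_cast
    have h2 : (2 : ℝ) ^ (n - 1) ≤ 2 ^ n := pow_le_pow_right₀ (by norm_num) (by omega)
    calc (2 : ℝ) ^ (n - 1) * (1 / 4) ^ n ≤ 2 ^ n * (1 / 4) ^ n :=
          mul_le_mul_of_nonneg_right h2 (by positivity)
      _ = (1 / 2) ^ n := by rw [← mul_pow]; norm_num
  exact Summable.of_nonneg_of_le (fun n => tsum_nonneg fun _ => by positivity) h
    (summable_geometric_of_lt_one (by norm_num) (by norm_num))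

theorem summable_weight : Summable fun w : Word => ((1 : ℝ) / 4) ^ weight w := by
  have hF : Function.Injective fun w : Word =>
      (⟨weight w, toComposition w⟩ : Σ n, Composition n) := by
    intro u v h
    have key : ∀ p q : (Σ n, Composition n), p = q → p.2.blocks = q.2.blocks := by
      rintro p q rfl; rfl
    have h2 : u.map (fun i : ℕ+ => (i : ℕ)) = v.map (fun i : ℕ+ => (i : ℕ)) := key _ _ h
    exact List.map_injective_iff.2 PNat.coe_injective h2
  have := summable_composition.comp_injective hF
  simpa only [Function.comp_def] using this

/-- The distance
`d(g, h) = ∑ₙ 4⁻ⁿ ∑_{i₁ + ⋯ + i_k = n} |Î(g) - Î(h)| / (1 + |Î(g) - Î(h)|)`, `Î = Î_{i₁,…,i_k}`,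
as a single sum over all multi-indices `(i₁, …, i_k)`; the empty one contributes zero. -/
def distance (g h : PathGroup T) : ℝ :=
  ∑' w : Word, (1 / 4) ^ weight w *
    (‖iterInt w g - iterInt w h‖ / (1 + ‖iterInt w g - iterInt w h‖))

theorem div_one_add_le_one {t : ℝ} (ht : 0 ≤ t) : t / (1 + t) ≤ 1 := by
  rw [div_le_one (by linarith)]; linarith

theorem div_one_add_mono {s t : ℝ} (hs : 0 ≤ s) (h : s ≤ t) : s / (1 + s) ≤ t / (1 + t) := by
  rw [div_le_div_iff₀ (by linarith) (by linarith)]; nlinarith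

theorem summable_distance (g h : PathGroup T) : Summable fun w : Word => ((1 : ℝ) / 4) ^ weight w *
    (‖iterInt w g - iterInt w h‖ / (1 + ‖iterInt w g - iterInt w h‖)) := by
  refine Summable.of_nonneg_of_le (fun w => by positivity) (fun w => ?_) summable_weight
  exact mul_le_of_le_one_right (by positivity) (div_one_add_le_one (norm_nonneg _))

theorem le_distance (g h : PathGroup T) (w : Word) : ((1 : ℝ) / 4) ^ weight w *
    (‖iterInt w g - iterInt w h‖ / (1 + ‖iterInt w g - iterInt w h‖)) ≤ distance g h :=
  (summable_distance g h).le_tsum w fun _ _ => by positivity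

/-- `G(X)` as a metric space, with the metric `d`. -/
instance : MetricSpace (PathGroup T) where
  dist := distance
  dist_self g := by simp [distance]
  dist_comm g h := by simp only [distance, norm_sub_rev]
  dist_triangle f g h := by
    rw [distance, distance, distance, ← (summable_distance f g).tsum_add (summable_distance g h)]
    refine (summable_distance f h).tsum_le_tsum (fun w => ?_)
      ((summable_distance f g).add (summable_distance g h))
    rw [← mul_add]
    gcongr
    set a := ‖iterInt w f - iterInt w g‖
    set b := ‖iterInt w g - iterInt w h‖
    have ha : 0 ≤ a := norm_nonneg _
    have hb : 0 ≤ b := norm_nonneg _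
    have hab : ‖iterInt w f - iterInt w h‖ ≤ a + b := norm_sub_le_norm_sub_add_norm_sub _ _ _
    calc _ ≤ (a + b) / (1 + (a + b)) := div_one_add_mono (norm_nonneg _) hab
      _ = a / (1 + (a + b)) + b / (1 + (a + b)) := add_div _ _ _
      _ ≤ a / (1 + a) + b / (1 + b) := by gcongr <;> linarith
  eq_of_dist_eq_zero {g h} hgh := by
    change distance g h = 0 at hgh
    refine toSeries_injective (Subtype.ext (funext fun w => ?_))
    have h1 := le_distance g h w
    rw [hgh] at h1
    by_contra hne
    have : 0 < ‖iterInt w g - iterInt w h‖ := norm_pos_iff.2 (sub_ne_zero.2 hne)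
    have : 0 < ((1 : ℝ) / 4) ^ weight w *
      (‖iterInt w g - iterInt w h‖ / (1 + ‖iterInt w g - iterInt w h‖)) := by positivity
    linarith

theorem dist_eq (g h : PathGroup T) : dist g h = distance g h := rfl

/-- The basic iterated integrals on `G(X)` are uniformly continuous. -/
theorem uniformContinuous_iterInt (w : Word) :
    UniformContinuous (iterInt w : PathGroup T → ℂ) := by
  rw [Metric.uniformContinuous_iff]
  intro ε hε
  refine ⟨((1 : ℝ) / 4) ^ weight w * (ε / (1 + ε)), by positivity, fun g h hgh => ?_⟩
  rw [dist_eq_norm]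
  by_contra hle
  have h1 := le_distance g h w
  have h2 := div_one_add_mono hε.le (not_lt.1 hle)
  have h3 : ((1 : ℝ) / 4) ^ weight w * (ε / (1 + ε)) ≤ ((1 : ℝ) / 4) ^ weight w *
      (‖iterInt w g - iterInt w h‖ / (1 + ‖iterInt w g - iterInt w h‖)) := by gcongr
  rw [dist_eq] at hgh
  linarith

theorem isUniformInducing_val_toSeries :
    IsUniformInducing (fun g : PathGroup T => g.toSeries.1) := by
  rw [isUniformInducing_iff']
  refine ⟨uniformContinuous_pi.2 uniformContinuous_iterInt, ?_⟩
  rw [Metric.uniformity_basis_dist.ge_iff]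
  intro ε hε
  set c : Word → ℝ := fun w => ((1 : ℝ) / 4) ^ weight w with hc
  have hc0 : ∀ w, 0 ≤ c w := fun w => by simp only [hc]; positivity
  have hsum : Summable c := summable_weight
  obtain ⟨s, hs⟩ : ∃ s : Finset Word, ∑' w, c w - ∑ w ∈ s, c w < ε / 2 := by
    have h1 := hsum.hasSum.eventually (lt_mem_nhds (show ∑' w, c w - ε / 2 < ∑' w, c w by linarith))
    obtain ⟨s, hs⟩ := h1.exists
    exact ⟨s, by linarith⟩
  set C : ℝ := ∑' w, c w
  have hC : 0 ≤ C := tsum_nonneg hc0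
  set δ : ℝ := ε / (2 * (C + 1)) with hδ
  have hδ0 : 0 < δ := by positivity
  have hU : {p : (Word → ℂ) × (Word → ℂ) | ∀ w ∈ s, dist (p.1 w) (p.2 w) < δ} ∈
      uniformity (Word → ℂ) := by
    have : {p : (Word → ℂ) × (Word → ℂ) | ∀ w ∈ s, dist (p.1 w) (p.2 w) < δ} =
        ⋂ w ∈ s, {p : (Word → ℂ) × (Word → ℂ) | dist (p.1 w) (p.2 w) < δ} := by
      ext p; simp
    rw [this, Filter.biInter_finset_mem]
    intro w _
    exact (Pi.uniformContinuous_proj (fun _ : Word => ℂ) w) (Metric.dist_mem_uniformity hδ0)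
  refine Filter.mem_comap.2 ⟨_, hU, ?_⟩
  rintro ⟨g, h⟩ hgh
  change distance g h < ε
  have hsm := summable_distance g h
  rw [distance, ← hsm.sum_add_tsum_subtype_compl s]
  have h1 : ∑ w ∈ s, ((1 : ℝ) / 4) ^ weight w *
      (‖iterInt w g - iterInt w h‖ / (1 + ‖iterInt w g - iterInt w h‖)) ≤ C * δ := by
    calc _ ≤ ∑ w ∈ s, c w * δ := by
          refine Finset.sum_le_sum fun w hw => ?_
          refine mul_le_mul_of_nonneg_left ?_ (hc0 w)
          have h2 : ‖iterInt w g - iterInt w h‖ < δ := by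
            rw [← dist_eq_norm]; exact hgh w hw
          exact (div_le_self (norm_nonneg _) (by linarith [norm_nonneg (iterInt w g - iterInt w h)])).trans
            h2.le
      _ = (∑ w ∈ s, c w) * δ := by rw [Finset.sum_mul]
      _ ≤ C * δ := by
          gcongr
          exact hsum.sum_le_tsum s fun w _ => hc0 w
  have h2 : ∑' w : {w // w ∉ s}, ((1 : ℝ) / 4) ^ weight w.1 *
      (‖iterInt w.1 g - iterInt w.1 h‖ / (1 + ‖iterInt w.1 g - iterInt w.1 h‖)) ≤
      C - ∑ w ∈ s, c w := by
    have hC' : C - ∑ w ∈ s, c w = ∑' w : {w // w ∉ s}, c w.1 := by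
      rw [sub_eq_iff_eq_add', hsum.sum_add_tsum_subtype_compl s]
    rw [hC']
    refine (hsm.subtype _).tsum_le_tsum (fun w => ?_) (hsum.subtype _)
    exact mul_le_of_le_one_right (hc0 _) (div_one_add_le_one (norm_nonneg _))
  have h3 : C * δ ≤ ε / 2 := by
    rw [hδ, ← mul_div_assoc, div_le_div_iff₀ (by positivity) (by norm_num)]
    nlinarith
  linarith

/-- The embedding of `G(X)` in the group of power series is uniform onto its image. -/
theorem isUniformInducing_toSeries :
    IsUniformInducing (toSeries : PathGroup T → SeriesGroup) :=
  ⟨by rw [← isUniformInducing_val_toSeries.comap_uniformity]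
      exact Filter.comap_comap⟩

/-- `G(X)` is a topological group. -/
instance : IsTopologicalGroup (PathGroup T) where
  continuous_mul := by
    rw [isUniformInducing_toSeries.isInducing.continuous_iff]
    have hc := (isUniformInducing_toSeries (T := T)).uniformContinuous.continuous
    have : (toSeries ∘ fun p : PathGroup T × PathGroup T => p.1 * p.2) =
        fun p => p.1.toSeries * p.2.toSeries := funext fun p => toSeries_mul _ _
    rw [this]
    exact (hc.comp continuous_fst).mul (hc.comp continuous_snd)
  continuous_inv := by
    rw [isUniformInducing_toSeries.isInducing.continuous_iff]
    have hc := (isUniformInducing_toSeries (T := T)).uniformContinuous.continuous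
    have : (toSeries ∘ fun g : PathGroup T => g⁻¹) = fun g => g.toSeries⁻¹ :=
      funext fun g => toSeries_inv _
    rw [this]
    exact hc.inv

/-- The embedding of `G(X)` in the group of power series as a homomorphism. -/
def toSeriesHom : PathGroup T →* SeriesGroup := MonoidHom.mk' toSeries toSeries_mul

end PathGroup

/-! ### The group of formal paths -/

/-- The group of formal paths `G_f(X)`: the completion of `G(X)` with respect to the metric `d`. -/
def FormalPathGroup (T : ℝ) [Fact (0 < T)] : Type := UniformSpace.Completion (PathGroup T)

namespace FormalPathGroup

variable [hT : Fact (0 < T)]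

/-- The metric of the completion. -/
instance : MetricSpace (FormalPathGroup T) :=
  inferInstanceAs (MetricSpace (UniformSpace.Completion (PathGroup T)))

/-- The canonical map from `G(X)` to its completion. -/
def ofPath (g : PathGroup T) : FormalPathGroup T := (g : UniformSpace.Completion (PathGroup T))

/-- The basic iterated integral on `G_f(X)`: the extension by continuity of the basic iterated
integral on `G(X)`. -/
def iterInt (w : Word) : FormalPathGroup T → ℂ :=
  UniformSpace.Completion.extension (PathGroup.iterInt w)

/-- The extension by continuity of the embedding of `G(X)` in the group of power series. -/
def toSeries : FormalPathGroup T → SeriesGroup :=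
  UniformSpace.Completion.extension PathGroup.toSeries

theorem denseRange_ofPath : DenseRange (ofPath : PathGroup T → FormalPathGroup T) :=
  UniformSpace.Completion.denseRange_coe

theorem continuous_ofPath : Continuous (ofPath : PathGroup T → FormalPathGroup T) :=
  UniformSpace.Completion.continuous_coe _

theorem continuous_iterInt (w : Word) : Continuous (iterInt w : FormalPathGroup T → ℂ) :=
  UniformSpace.Completion.continuous_extension

theorem iterInt_ofPath (w : Word) (g : PathGroup T) : iterInt w (ofPath g) = g.iterInt w :=
  UniformSpace.Completion.extension_coe (PathGroup.uniformContinuous_iterInt w) g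

theorem toSeries_ofPath (g : PathGroup T) : toSeries (ofPath g) = g.toSeries :=
  UniformSpace.Completion.extension_coe PathGroup.isUniformInducing_toSeries.uniformContinuous g

theorem isUniformInducing_toSeries :
    IsUniformInducing (toSeries : FormalPathGroup T → SeriesGroup) :=
  UniformSpace.Completion.isUniformInducing_extension PathGroup.isUniformInducing_toSeries

theorem toSeries_injective : Function.Injective (toSeries : FormalPathGroup T → SeriesGroup) :=
  isUniformInducing_toSeries.injective

theorem range_toSeries : Set.range (toSeries : FormalPathGroup T → SeriesGroup) =
    ((PathGroup.toSeriesHom (T := T)).range.topologicalClosure : Set SeriesGroup) := by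
  have hc : Continuous (toSeries : FormalPathGroup T → SeriesGroup) :=
    isUniformInducing_toSeries.uniformContinuous.continuous
  have hcs : CompleteSpace (FormalPathGroup T) :=
    inferInstanceAs (CompleteSpace (UniformSpace.Completion (PathGroup T)))
  rw [Subgroup.topologicalClosure_coe]
  apply Set.Subset.antisymm
  · have h1 := hc.range_subset_closure_image_dense (denseRange_ofPath (T := T))
    rw [← Set.range_comp] at h1
    refine h1.trans (closure_mono ?_)
    rintro _ ⟨g, rfl⟩
    exact ⟨g, (toSeries_ofPath g).symm⟩
  · refine closure_minimal ?_
      (isUniformInducing_toSeries.isComplete_range).isClosed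
    rintro _ ⟨g, rfl⟩
    exact ⟨ofPath g, toSeries_ofPath g⟩

/-- The bijection of `G_f(X)` with the closure of `G(X)` in the group of power series. -/
def equivClosure :
    FormalPathGroup T ≃ (PathGroup.toSeriesHom (T := T)).range.topologicalClosure :=
  (Equiv.ofInjective toSeries toSeries_injective).trans (Equiv.setCongr range_toSeries)

theorem coe_equivClosure (g : FormalPathGroup T) : (equivClosure g : SeriesGroup) = toSeries g :=
  rfl

/-- The group structure of `G_f(X)`. It is the one for which `G(X) → G_f(X)` is a homomorphism and
the operations are continuous (see `ofPath_mul` and the instance below), and it is unique as such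
by density; it is obtained here from the closure of `G(X)` in the group of power series. -/
instance : Group (FormalPathGroup T) := equivClosure.group

theorem toSeries_mul (g h : FormalPathGroup T) : toSeries (g * h) = toSeries g * toSeries h := by
  have : equivClosure (g * h) = equivClosure g * equivClosure h :=
    map_mul (equivClosure (T := T)).mulEquiv g h
  simpa [coe_equivClosure] using congrArg Subtype.val this

theorem ofPath_mul (g h : PathGroup T) : ofPath (g * h) = ofPath g * ofPath h :=
  toSeries_injective (by simp only [toSeries_mul, toSeries_ofPath, PathGroup.toSeries_mul])

/-- The embedding of `G_f(X)` in the group of power series as a homomorphism. -/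
def toSeriesHom : FormalPathGroup T →* SeriesGroup := MonoidHom.mk' toSeries toSeries_mul

/-- `G_f(X)` is a topological group. -/
instance : IsTopologicalGroup (FormalPathGroup T) where
  continuous_mul := by
    rw [isUniformInducing_toSeries.isInducing.continuous_iff]
    have hc := (isUniformInducing_toSeries (T := T)).uniformContinuous.continuous
    have : (toSeries ∘ fun p : FormalPathGroup T × FormalPathGroup T => p.1 * p.2) =
        fun p => toSeries p.1 * toSeries p.2 := funext fun p => toSeries_mul _ _
    rw [this]
    exact (hc.comp continuous_fst).mul (hc.comp continuous_snd)
  continuous_inv := by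
    rw [isUniformInducing_toSeries.isInducing.continuous_iff]
    have hc := (isUniformInducing_toSeries (T := T)).uniformContinuous.continuous
    have : (toSeries ∘ fun g : FormalPathGroup T => g⁻¹) = fun g => (toSeries g)⁻¹ :=
      funext fun g => map_inv (toSeriesHom (T := T)) g
    rw [this]
    exact hc.inv

end FormalPathGroup

/-- The `n`-th term of the topological lower central series of a topological group `G`: the closure
of `Gₙ`, where `G₁ = [G, G]` and `Gₙ = [G, Gₙ₋₁]` (and `G₀ = G`). -/
def topLowerCentralSeries (G : Type*) [Group G] [TopologicalSpace G] (n : ℕ) : Set G :=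
  closure ((⊤ : Subgroup G).lowerCentralSeries n : Set G)

end FormalPaths

end

/-! Taking all iterated integrals embeds `G(X)` and `G_f(X)`, as topological groups, in the group of
noncommutative power series; `G_f(X)` becomes the closure of `G(X)` there. Both parts then follow
from one characterization, valid in either group: the closed lower central term of index `n`
consists of the elements whose series has no nonempty word of length at most `n`.

Necessity is formal. If `f` starts in length `m + 1`, then `f g` and `g f` agree up to length `m +
1`, so a commutator with `f` starts in length at least `m + 2` (`SeriesGroup.commutator_apply`). The
vanishing conditions are closed, so they pass to closures.

Sufficiency rests on the fact that the leading term of a path is a Lie element, proved without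
shuffle relations by a Dynkin-Specht-Wever argument. Write `[f]` for the Dynkin bracketing of `f`
and `D` for the derivation given by word length. The series of iterated integrals over `[x, T]`
solves `F' = -A F` with `F(T) = 1`, and the defect `D F - [F] F` solves the same linear equation
with end value zero, so it vanishes (`PathSpace.dynkinDefect_iterInt`). The identity `D f = [f] f`
persists in the closure, and in the lowest length `m + 1` it reads `(m + 1) f = [f]`
(`SeriesGroup.dynkin_eq_of_vanishesUpTo`).

Conversely, iterated commutators of paths realize any bracketing `[f]` as leading term
(`PathGroup.exists_toSeries_eq_dynkin`). Hence the leading term of an error can be removed by an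
element of the lower central series of `G(X)`, one length at a time. Each step handles finitely many
letters, so that only finite products are needed; letting both the length and the alphabet grow
gives convergence (`PathGroup.mem_closure_lowerCentralSeries`). The approximants lie in `G(X)` even
when the limit is only in `G_f(X)`, so the same argument serves both groups. -/

noncomputable section

namespace FormalPaths

/-! ### The transposed Dynkin operator -/

/-- The transpose of the Dynkin operator `i₁ ⋯ i_k ↦ [i₁, [i₂, …, [i_{k-1}, i_k]]]`: the series
`∑ f(w) [w]`, where `[w]` is the right-normed bracket of the letters of `w`. -/
def dynkin (f : Word → ℂ) : Word → ℂ
  | [] => 0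
  | i :: v => (if v = [] then f [i] else 0) + dynkin (fun w => f (i :: w)) v -
      dynkin (fun w => f ((i :: v).getLast (List.cons_ne_nil i v) :: w)) (i :: v).dropLast
termination_by w => w.length
decreasing_by all_goals simp

theorem dynkin_nil (f : Word → ℂ) : dynkin f [] = 0 := dynkin.eq_1 f

theorem dynkin_cons (f : Word → ℂ) (i : ℕ+) (v : Word) :
    dynkin f (i :: v) = (if v = [] then f [i] else 0) + dynkin (fun w => f (i :: w)) v -
      dynkin (fun w => f ((i :: v).getLast (List.cons_ne_nil i v) :: w)) (i :: v).dropLast :=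
  dynkin.eq_2 f i v

/-- Induction along the recursion that defines `dynkin`. -/
theorem dynkin_induction {P : Word → Prop} (nil : P [])
    (cons : ∀ (i : ℕ+) (v : Word), P v → P (i :: v).dropLast → P (i :: v)) (u : Word) : P u := by
  induction h : u.length using Nat.strong_induction_on generalizing u with
  | _ n ih =>
    cases u with
    | nil => exact nil
    | cons i v =>
      exact cons i v (ih _ (by simp at h; omega) v rfl) (ih _ (by simp at h ⊢; omega) _ rfl)

theorem dynkin_const_mul (c : ℂ) (f : Word → ℂ) (u : Word) :
    dynkin (fun w => c * f w) u = c * dynkin f u := by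
  induction u using dynkin_induction generalizing f with
  | nil => simp [dynkin_nil]
  | cons i v h₁ h₂ =>
    rw [dynkin_cons, dynkin_cons f, h₁ fun w => f (i :: w), h₂ fun w => f (_ :: w)]
    split_ifs <;> ring

/-- The bracketing never reads the constant term, so in particular it kills the unit series. -/
theorem dynkin_eq_zero {f : Word → ℂ} (hf : ∀ w, w ≠ [] → f w = 0) (u : Word) :
    dynkin f u = 0 := by
  induction u using dynkin_induction generalizing f with
  | nil => exact dynkin_nil f
  | cons i v h₁ h₂ =>
    rw [dynkin_cons, h₁ fun w _ => hf _ (by simp), h₂ fun w _ => hf _ (by simp),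
      hf [i] (by simp)]
    simp

theorem continuous_dynkin (u : Word) : Continuous fun f : Word → ℂ => dynkin f u := by
  induction u using dynkin_induction with
  | nil => simp only [dynkin_nil]; exact continuous_const
  | cons i v h₁ h₂ =>
    simp only [dynkin_cons]
    have hs (j : ℕ+) : Continuous fun (f : Word → ℂ) (w : Word) => f (j :: w) :=
      continuous_pi fun w => continuous_apply _
    refine (Continuous.add ?_ (h₁.comp (hs i))).sub (h₂.comp (hs _))
    split_ifs
    · exact continuous_apply _
    · exact continuous_const

/-- The product of `f` with the linear series `∑ αᵢ i` on the left. -/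
def linearMul (α : ℕ+ → ℂ) (f : Word → ℂ) : Word → ℂ
  | [] => 0
  | i :: w => α i * f w

theorem conv_linearMul (α : ℕ+ → ℂ) (f g : Word → ℂ) (w : Word) :
    conv (linearMul α f) g w = linearMul α (conv f g) w := by
  cases w with
  | nil => simp [conv_nil, linearMul]
  | cons i w => rw [conv_cons]; simp [linearMul, conv_const_mul_left]

theorem conv_sub_left (f₁ f₂ g : Word → ℂ) (w : Word) :
    conv (fun u => f₁ u - f₂ u) g w = conv f₁ g w - conv f₂ g w := by
  simp [conv, sub_mul, Finset.sum_sub_distrib]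

theorem conv_neg_left (f g : Word → ℂ) (w : Word) :
    conv (fun u => -f u) g w = -conv f g w := by
  simp [conv]

theorem conv_neg_right (f g : Word → ℂ) (w : Word) :
    conv f (fun u => -g u) w = -conv f g w := by
  simp [conv]

/-- Multiplying by a linear series on the right leaves only the split that cuts off the last letter.
This matches the subtracted term in the recursion for `dynkin`. -/
theorem conv_linearMul_unitSeries (α : ℕ+ → ℂ) (f : Word → ℂ) (i : ℕ+) (v : Word) :
    conv f (linearMul α unitSeries) (i :: v) =
      α ((i :: v).getLast (List.cons_ne_nil i v)) * f (i :: v).dropLast := by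
  induction v generalizing i f with
  | nil => simp [conv_cons, conv_nil, linearMul, unitSeries, mul_comm]
  | cons j v ih => rw [conv_cons, ih]; simp [linearMul, unitSeries]

/-- The operator `dynkin` turns left multiplication by `A = ∑ αᵢ i` into `y ↦ A + [A, y]`. -/
theorem dynkin_linearMul (α : ℕ+ → ℂ) {f : Word → ℂ} (hf : f [] = 1) (u : Word) :
    dynkin (linearMul α f) u = linearMul α unitSeries u + linearMul α (dynkin f) u -
      conv (dynkin f) (linearMul α unitSeries) u := by
  cases u with
  | nil => simp [dynkin_nil, linearMul, conv_nil]
  | cons i v =>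
    rw [conv_linearMul_unitSeries, dynkin_cons]
    simp only [linearMul, dynkin_const_mul]
    cases v <;> simp [hf, unitSeries]

/-- The defect of a series in the equation `D f = [f] f`, in which `D` is the derivation that
multiplies a word by its length and `[f] = dynkin f`. -/
def dynkinDefect (f : Word → ℂ) (u : Word) : ℂ := u.length * f u - conv (dynkin f) f u

/-- The left side is the formal derivative of the defect `D f - [f] f` along `f' = -A f`. Since `[A
f] = A + A [f] - [f] A`, the two terms `[f] A f` cancel, and the lone `A f` is absorbed by `D(A f) =
A f + A D f`. -/
theorem dynkinDefect_linearMul (α : ℕ+ → ℂ) {f : Word → ℂ} (hf : f [] = 1) (u : Word) :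
    u.length * -linearMul α f u - (conv (dynkin fun w => -linearMul α f w) f u +
      conv (dynkin f) (fun w => -linearMul α f w) u) = -linearMul α (dynkinDefect f) u := by
  have h₁ : dynkin (fun w => -linearMul α f w) = fun u => -(linearMul α unitSeries u +
      linearMul α (dynkin f) u - conv (dynkin f) (linearMul α unitSeries) u) := by
    funext u
    rw [← dynkin_linearMul α hf, ← neg_one_mul, ← dynkin_const_mul]
    simp
  have h₂ : conv (linearMul α unitSeries) f = linearMul α f := by
    funext u
    rw [conv_linearMul, funext (unitSeries_conv f)]
  rw [h₁, conv_neg_left, conv_neg_right, conv_sub_left, conv_add_left, conv_assoc, h₂,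
    conv_linearMul]
  cases u with
  | nil => simp [linearMul]
  | cons i u => simp only [linearMul, dynkinDefect, List.length_cons]; push_cast; ring

theorem dynkinDefect_unitSeries (u : Word) : dynkinDefect unitSeries u = 0 := by
  rw [dynkinDefect, conv_unitSeries, dynkin_eq_zero]
  · cases u <;> simp [unitSeries]
  · intro w hw
    cases w with
    | nil => exact absurd rfl hw
    | cons i w => rfl

/-! ### Absolutely continuous functions with a given derivative -/

/-- `f` is absolutely continuous between `a` and `b` and its derivative is almost everywhere `φ`. -/
structure IsPrimitiveOn (f φ : ℝ → ℂ) (a b : ℝ) : Prop where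
  absCont : AbsolutelyContinuousOnInterval f a b
  hasDerivAt : ∀ᵐ x, x ∈ Set.uIcc a b → HasDerivAt f (φ x) x

namespace IsPrimitiveOn

variable {f g φ ψ : ℝ → ℂ} {a b : ℝ}

theorem const (c : ℂ) : IsPrimitiveOn (fun _ => c) (fun _ => 0) a b where
  absCont := (LipschitzWith.const c).lipschitzOnWith.absolutelyContinuousOnInterval
  hasDerivAt := Filter.Eventually.of_forall fun x _ => hasDerivAt_const x c

theorem add (hf : IsPrimitiveOn f φ a b) (hg : IsPrimitiveOn g ψ a b) :
    IsPrimitiveOn (fun x => f x + g x) (fun x => φ x + ψ x) a b where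
  absCont := hf.absCont.fun_add hg.absCont
  hasDerivAt := by
    filter_upwards [hf.hasDerivAt, hg.hasDerivAt] with x h₁ h₂ hx using (h₁ hx).add (h₂ hx)

theorem sub (hf : IsPrimitiveOn f φ a b) (hg : IsPrimitiveOn g ψ a b) :
    IsPrimitiveOn (fun x => f x - g x) (fun x => φ x - ψ x) a b where
  absCont := hf.absCont.fun_sub hg.absCont
  hasDerivAt := by
    filter_upwards [hf.hasDerivAt, hg.hasDerivAt] with x h₁ h₂ hx using (h₁ hx).sub (h₂ hx)

theorem mul (hf : IsPrimitiveOn f φ a b) (hg : IsPrimitiveOn g ψ a b) :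
    IsPrimitiveOn (fun x => f x * g x) (fun x => φ x * g x + f x * ψ x) a b where
  absCont := hf.absCont.fun_smul hg.absCont
  hasDerivAt := by
    filter_upwards [hf.hasDerivAt, hg.hasDerivAt] with x h₁ h₂ hx using (h₁ hx).mul (h₂ hx)

theorem const_mul (c : ℂ) (hf : IsPrimitiveOn f φ a b) :
    IsPrimitiveOn (fun x => c * f x) (fun x => c * φ x) a b := by
  simpa using (const c).mul hf

/-- The bound makes the primitive Lipschitz, hence absolutely continuous; its derivative is given
almost everywhere by Lebesgue differentiation. -/
theorem integral (hφ : IntervalIntegrable φ MeasureTheory.volume a b) {M : ℝ}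
    (hM : ∀ x ∈ Set.uIcc a b, ‖φ x‖ ≤ M) : IsPrimitiveOn (fun x => ∫ s in b..x, φ s) φ a b where
  absCont := by
    refine (LipschitzOnWith.of_dist_le_mul (K := M.toNNReal) fun x hx y hy => ?_
      ).absolutelyContinuousOnInterval
    have hi (z : ℝ) (hz : z ∈ Set.uIcc a b) :
        IntervalIntegrable φ MeasureTheory.volume b z :=
      hφ.mono_set (Set.uIcc_subset_uIcc Set.right_mem_uIcc hz)
    rw [dist_eq_norm, intervalIntegral.integral_interval_sub_left (hi x hx) (hi y hy),
      Real.coe_toNNReal _ ((norm_nonneg _).trans (hM x hx)), Real.dist_eq]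
    exact intervalIntegral.norm_integral_le_of_norm_le_const fun z hz =>
      hM z (Set.uIcc_subset_uIcc hy hx (Set.uIoc_subset_uIcc hz))
  hasDerivAt := by
    filter_upwards [hφ.ae_hasDerivAt_integral] with x hx h using hx h b Set.right_mem_uIcc

theorem sum {ι : Type*} (s : Finset ι) {f φ : ι → ℝ → ℂ}
    (h : ∀ j, IsPrimitiveOn (f j) (φ j) a b) :
    IsPrimitiveOn (fun x => ∑ j ∈ s, f j x) (fun x => ∑ j ∈ s, φ j x) a b := by
  classical
  induction s using Finset.induction_on with
  | empty => simpa using const 0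
  | insert j s hj ih => simp only [Finset.sum_insert hj]; exact (h j).add ih

/-- Absolute continuity is essential here: a derivative that vanishes only almost everywhere does
not by itself force a continuous function to be constant. -/
theorem eq_of_eq_zero (hf : IsPrimitiveOn f φ a b) (hφ : ∀ x ∈ Set.uIcc a b, φ x = 0) {x : ℝ}
    (hx : x ∈ Set.uIcc a b) : f x = f b := by
  obtain ⟨C, hC⟩ := hf.absCont.const_of_ae_hasDerivAt_zero (by
    filter_upwards [hf.hasDerivAt] with x h hx
    simpa only [hφ x hx] using h hx)
  rw [hC x hx, hC b Set.right_mem_uIcc]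

variable {F G Φ Ψ : ℝ → Word → ℂ}

theorem conv (hF : ∀ w, IsPrimitiveOn (fun x => F x w) (fun x => Φ x w) a b)
    (hG : ∀ w, IsPrimitiveOn (fun x => G x w) (fun x => Ψ x w) a b) (w : Word) :
    IsPrimitiveOn (fun x => FormalPaths.conv (F x) (G x) w)
      (fun x => FormalPaths.conv (Φ x) (G x) w + FormalPaths.conv (F x) (Ψ x) w) a b := by
  simp only [FormalPaths.conv, ← Finset.sum_add_distrib]
  exact sum _ fun j => (hF _).mul (hG _)

/-- Each coefficient of the bracketing is a fixed finite linear combination of coefficients of the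
series, so it commutes with differentiation. -/
theorem dynkin (hF : ∀ w, IsPrimitiveOn (fun x => F x w) (fun x => Φ x w) a b) (u : Word) :
    IsPrimitiveOn (fun x => FormalPaths.dynkin (F x) u) (fun x => FormalPaths.dynkin (Φ x) u)
      a b := by
  induction u using dynkin_induction generalizing F Φ with
  | nil => simpa only [dynkin_nil] using const 0
  | cons i v h₁ h₂ =>
    simp only [dynkin_cons]
    refine (add ?_ (h₁ fun w => hF _)).sub (h₂ fun w => hF _)
    split_ifs
    · exact hF _
    · exact const 0

end IsPrimitiveOn

/-! ### The Dynkin identity for iterated integrals -/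

namespace PathSpace

variable {T : ℝ}

/-- This is the equation `F' = -A F`, in the variable lower endpoint: the first letter of a word
belongs to the outermost integral, so differentiating strips it. -/
theorem isPrimitiveOn_integralFrom (a : PathSpace T) (w : Word) :
    IsPrimitiveOn (integralFrom a w)
      (fun x => -linearMul (fun i => a.coeff i x) (fun u => integralFrom a u x) w) 0 T := by
  cases w with
  | nil => simp only [linearMul, neg_zero]; exact .const 1
  | cons i w =>
    obtain ⟨A, hA⟩ := a.bounded
    obtain ⟨B, hB⟩ := isCompact_uIcc.exists_bound_of_continuousOn (s := Set.uIcc 0 T)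
      (continuous_integralFrom a w).continuousOn
    have hint := intervalIntegrable_mul a i (continuous_integralFrom a w) 0 T
    have h : integralFrom a (i :: w) =
        fun x => (0 : ℂ) - ∫ s in T..x, a.coeff i s * integralFrom a w s := by
      funext x
      rw [integralFrom, intervalIntegral.integral_symm, zero_sub]
    have h' : IsPrimitiveOn (fun x => ∫ s in T..x, a.coeff i s * integralFrom a w s)
        (fun x => a.coeff i x * integralFrom a w x) 0 T :=
      .integral hint (M := A ^ (i : ℕ) * B) fun x hx => by
        rw [norm_mul]
        exact mul_le_mul (hA i x) (hB x hx) (norm_nonneg _) ((norm_nonneg _).trans (hA i x))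
    rw [h]
    simpa [linearMul] using (IsPrimitiveOn.const (0 : ℂ)).sub h'

theorem integralFrom_right (a : PathSpace T) (w : Word) : integralFrom a w T = unitSeries w := by
  cases w with
  | nil => rfl
  | cons i w => exact integralFrom_end a i w

theorem dynkinDefect_integralFrom (a : PathSpace T) (u : Word) (x : ℝ)
    (hx : x ∈ Set.uIcc 0 T) : dynkinDefect (fun w => integralFrom a w x) u = 0 := by
  have hF := isPrimitiveOn_integralFrom a
  have key (u : Word) : IsPrimitiveOn (fun x => dynkinDefect (fun w => integralFrom a w x) u)
      (fun x => -linearMul (fun i => a.coeff i x)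
        (dynkinDefect fun w => integralFrom a w x) u) 0 T := by
    have h := ((hF u).const_mul u.length).sub
      (IsPrimitiveOn.conv (F := fun x => dynkin fun w => integralFrom a w x)
        (G := fun x w => integralFrom a w x) (fun w => IsPrimitiveOn.dynkin hF w) hF u)
    have h' (x : ℝ) := dynkinDefect_linearMul (fun i => a.coeff i x)
      (f := fun w => integralFrom a w x) rfl u
    simp only [h'] at h
    exact h
  have hT (u : Word) : dynkinDefect (fun w => integralFrom a w T) u = 0 := by
    rw [funext (integralFrom_right a), dynkinDefect_unitSeries]
  -- The equation is triangular: the derivative of the defect at `i :: u` involves only its value at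
  -- `u`, which is already zero. So each coefficient is constant and equals its value at `T`.
  induction u generalizing x with
  | nil => rw [(key _).eq_of_eq_zero (by simp [linearMul]) hx, hT]
  | cons i u ih =>
    rw [(key _).eq_of_eq_zero (fun y hy => by simp [linearMul, ih y hy]) hx, hT]

theorem dynkinDefect_iterInt (a : PathSpace T) (u : Word) : dynkinDefect a.iterInt u = 0 :=
  dynkinDefect_integralFrom a u 0 Set.left_mem_uIcc

end PathSpace

open scoped commutatorElement

/-! ### Series without short words -/

/-- The coefficients of `f` vanish at the nonempty words of length at most `m` in the letters of
`S`. -/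
def VanishesUpTo (S : Set ℕ+) (m : ℕ) (f : Word → ℂ) : Prop :=
  ∀ w : Word, w ≠ [] → w.length ≤ m → (∀ i ∈ w, i ∈ S) → f w = 0

section VanishesUpTo

variable {S : Set ℕ+} {f g h : Word → ℂ} {m p q : ℕ} {w : Word}

theorem vanishesUpTo_zero (f : Word → ℂ) : VanishesUpTo S 0 f := fun _ h₀ h₁ _ =>
  absurd (List.length_eq_zero_iff.1 (Nat.le_zero.1 h₁)) h₀

theorem mem_of_mem_take {j : ℕ} (hw : ∀ i ∈ w, i ∈ S) : ∀ i ∈ w.take j, i ∈ S :=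
  fun i hi => hw i (List.mem_of_mem_take hi)

theorem mem_of_mem_drop {j : ℕ} (hw : ∀ i ∈ w, i ∈ S) : ∀ i ∈ w.drop j, i ∈ S :=
  fun i hi => hw i (List.mem_of_mem_drop hi)

/-- The first and last terms of a convolution. -/
theorem conv_eq_add_sum (f g : Word → ℂ) (hw : w ≠ []) : conv f g w =
    f [] * g w + f w * g [] +
      ∑ j ∈ Finset.Ico 1 w.length, f (w.take j) * g (w.drop j) := by
  have hl : 0 < w.length := List.length_pos_iff.2 hw
  rw [conv, Finset.sum_range_succ, Finset.range_eq_Ico, Finset.sum_eq_sum_Ico_succ_bot hl]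
  simp
  ring

/-- Convolution is additive on words that are too short to see the product of the two leading
terms. -/
theorem conv_eq_add (hf₁ : f [] = 1) (hg₁ : g [] = 1) (hf : VanishesUpTo S p f)
    (hg : VanishesUpTo S q g) (hw₀ : w ≠ []) (hw : w.length ≤ p + q + 1)
    (hwS : ∀ i ∈ w, i ∈ S) : conv f g w = f w + g w := by
  rw [conv_eq_add_sum f g hw₀, Finset.sum_eq_zero, hf₁, hg₁]
  · ring
  · intro j hj
    rw [Finset.mem_Ico] at hj
    rcases le_or_gt j p with h | h
    · rw [hf _ _ _ (mem_of_mem_take hwS), zero_mul]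
      · exact List.ne_nil_of_length_pos (by rw [List.length_take]; omega)
      · rw [List.length_take]; omega
    · rw [hg _ _ _ (mem_of_mem_drop hwS), mul_zero]
      · exact List.ne_nil_of_length_pos (by rw [List.length_drop]; omega)
      · rw [List.length_drop]; omega

/-- If `f k` and `f` agree up to length `m` then `k` has no short words, and its coefficients of
length `m + 1` are the differences. -/
theorem eq_sub_of_conv_eq {k : Word → ℂ} (hf₁ : f [] = 1) (hk₁ : k [] = 1)
    (hk : conv f k = h) (hfh : ∀ w : Word, w ≠ [] → w.length ≤ m → (∀ i ∈ w, i ∈ S) → h w = f w) :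
    VanishesUpTo S m k ∧
      ∀ w : Word, w ≠ [] → w.length ≤ m + 1 → (∀ i ∈ w, i ∈ S) → k w = h w - f w := by
  -- Bootstrap: absence of words up to length `p` makes the product additive up to length `p + 1`,
  -- which identifies the next layer of `k`.
  have key (p : ℕ) (hp : VanishesUpTo S p k) (w : Word) (hw₀ : w ≠ []) (hw : w.length ≤ p + 1)
      (hwS : ∀ i ∈ w, i ∈ S) : k w = h w - f w := by
    rw [← hk, conv_eq_add hf₁ hk₁ (vanishesUpTo_zero f) hp hw₀ (by omega) hwS]
    ring
  have hm (p : ℕ) (hp : p ≤ m) : VanishesUpTo S p k := by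
    induction p with
    | zero => exact vanishesUpTo_zero k
    | succ p ih =>
      intro w hw₀ hw hwS
      rw [key p (ih (by omega)) w hw₀ hw hwS, hfh w hw₀ (by omega) hwS, sub_self]
  exact ⟨hm m le_rfl, key m (hm m le_rfl)⟩

end VanishesUpTo

/-! ### The filtration of the series group by word length -/

namespace SeriesGroup

variable {S : Set ℕ+} {m : ℕ}

theorem continuous_val : Continuous fun f : SeriesGroup => f.1 :=
  (continuous_subtype_val : Continuous (Subtype.val : {f : Word → ℂ // f [] = 1} → Word → ℂ))

theorem continuous_coeff (w : Word) : Continuous fun f : SeriesGroup => f.1 w :=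
  (continuous_apply w).comp continuous_val

theorem coe_mul (f g : SeriesGroup) : (f * g).1 = conv g.1 f.1 := rfl

theorem mul_apply {f g : SeriesGroup} (hf : VanishesUpTo S m f.1) (hg : VanishesUpTo S m g.1)
    {w : Word} (hw₀ : w ≠ []) (hw : w.length ≤ m + 1) (hwS : ∀ i ∈ w, i ∈ S) :
    (f * g).1 w = f.1 w + g.1 w := by
  rw [coe_mul, conv_eq_add g.2 f.2 hg hf hw₀ (by omega) hwS, add_comm]

/-- If `f` and `g` agree up to length `m` then `f * g⁻¹` has no words of length at most `m`, and its
coefficients of length `m + 1` are the differences. -/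
theorem mul_inv_apply {f g : SeriesGroup}
    (hfg : ∀ w : Word, w ≠ [] → w.length ≤ m → (∀ i ∈ w, i ∈ S) → f.1 w = g.1 w) :
    VanishesUpTo S m (f * g⁻¹).1 ∧
      ∀ w : Word, w ≠ [] → w.length ≤ m + 1 → (∀ i ∈ w, i ∈ S) →
        (f * g⁻¹).1 w = f.1 w - g.1 w :=
  eq_sub_of_conv_eq g.2 (f * g⁻¹).2 (by rw [← coe_mul, inv_mul_cancel_right]) hfg

/-- The subgroup of the series whose coefficients vanish at the nonempty words of length at most
`m`. -/
def longWords (m : ℕ) : Subgroup SeriesGroup where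
  carrier := {f | VanishesUpTo Set.univ m f.1}
  one_mem' := fun w hw _ _ => by
    cases w with
    | nil => exact absurd rfl hw
    | cons i w => rfl
  mul_mem' := fun {f g} hf hg w hw₀ hw hwS => by
    rw [mul_apply hf hg hw₀ (by omega) hwS, hf w hw₀ hw hwS, hg w hw₀ hw hwS, add_zero]
  inv_mem' := fun {f} hf => by
    -- The inverse is the quotient `1 * f⁻¹`, and `f` agrees with `1` up to length `m`.
    have h := (mul_inv_apply (S := Set.univ) (m := m) (f := 1) (g := f)
      fun w hw₀ hw hwS => ?_).1
    · rwa [one_mul] at h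
    · rw [hf w hw₀ hw hwS]
      cases w with
      | nil => exact absurd rfl hw₀
      | cons i w => rfl

theorem mem_longWords {f : SeriesGroup} :
    f ∈ longWords m ↔ ∀ w : Word, w ≠ [] → w.length ≤ m → f.1 w = 0 :=
  ⟨fun h w h₀ h₁ => h w h₀ h₁ fun _ _ => trivial, fun h w h₀ h₁ _ => h w h₀ h₁⟩

theorem isClosed_longWords (m : ℕ) : IsClosed (longWords m : Set SeriesGroup) := by
  have : (longWords m : Set SeriesGroup) =
      ⋂ (w : Word) (_ : w ≠ []) (_ : w.length ≤ m), {f | f.1 w = 0} := by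
    ext f
    simp [mem_longWords]
  rw [this]
  exact isClosed_iInter fun w => isClosed_iInter fun _ => isClosed_iInter fun _ =>
    isClosed_eq (continuous_coeff w) continuous_const

/-- The commutator of a series without words of length at most `m` with an arbitrary one. -/
theorem commutator_apply {f g : SeriesGroup} (hf : f ∈ longWords m) :
    ⁅f, g⁆ ∈ longWords (m + 1) ∧ ∀ w : Word, w.length = m + 2 → ⁅f, g⁆.1 w =
      g.1 (w.take 1) * f.1 (w.drop 1) - f.1 (w.take (m + 1)) * g.1 (w.drop (m + 1)) := by
  -- This is `⁅f, g⁆ g f = f g`, with the factors reversed because the group product is the opposite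
  -- of `conv`. Thus the commutator measures the difference of `f g` and `g f`.
  have hk : conv (g * f).1 ⁅f, g⁆.1 = (f * g).1 := by
    rw [← coe_mul, commutatorElement_def]
    exact congrArg Subtype.val (by group; rfl)
  have hS (w : Word) : ∀ i ∈ w, i ∈ Set.univ := fun _ _ => trivial
  have h := eq_sub_of_conv_eq (S := Set.univ) (m := m + 1) (g * f).2 ⁅f, g⁆.2 hk
    fun w hw₀ hw hwS => by
      rw [coe_mul, coe_mul, conv_eq_add g.2 f.2 (vanishesUpTo_zero _) hf hw₀ (by omega) hwS,
        conv_eq_add f.2 g.2 hf (vanishesUpTo_zero _) hw₀ (by omega) hwS, add_comm]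
  refine ⟨h.1, fun w hw => ?_⟩
  have hw₀ : w ≠ [] := List.ne_nil_of_length_pos (by omega)
  -- In length `m + 2` a proper split contributes only if the factor from `f` has length `m + 1`,
  -- leaving a single letter for `g`.
  have h₁ : ∑ j ∈ Finset.Ico 1 w.length, g.1 (w.take j) * f.1 (w.drop j) =
      g.1 (w.take 1) * f.1 (w.drop 1) := by
    refine Finset.sum_eq_single_of_mem 1 (by simp; omega) fun j hj hj1 => ?_
    rw [Finset.mem_Ico] at hj
    rw [mem_longWords.1 hf, mul_zero]
    · exact List.ne_nil_of_length_pos (by rw [List.length_drop]; omega)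
    · rw [List.length_drop]; omega
  have h₂ : ∑ j ∈ Finset.Ico 1 w.length, f.1 (w.take j) * g.1 (w.drop j) =
      f.1 (w.take (m + 1)) * g.1 (w.drop (m + 1)) := by
    refine Finset.sum_eq_single_of_mem (m + 1) (by simp; omega) fun j hj hj1 => ?_
    rw [Finset.mem_Ico] at hj
    rw [mem_longWords.1 hf, zero_mul]
    · exact List.ne_nil_of_length_pos (by rw [List.length_take]; omega)
    · rw [List.length_take]; omega
  rw [h.2 w hw₀ (by omega) (hS w), coe_mul, coe_mul, conv_eq_add_sum _ _ hw₀,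
    conv_eq_add_sum _ _ hw₀, h₁, h₂, f.2, g.2]
  ring

/-- A homomorphism to `SeriesGroup` maps the `n`-th term of the lower central series to series
without words of length at most `n`. -/
theorem lowerCentralSeries_le_comap_longWords {H : Type*} [Group H] (φ : H →* SeriesGroup)
    (n : ℕ) : (⊤ : Subgroup H).lowerCentralSeries n ≤ (longWords n).comap φ := by
  induction n with
  | zero =>
    intro x _
    exact mem_longWords.2 fun w h₀ h₁ =>
      absurd (List.length_eq_zero_iff.1 (Nat.le_zero.1 h₁)) h₀
  | succ n ih =>
    rw [Subgroup.lowerCentralSeries_succ, Subgroup.commutator_le]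
    intro x hx y _
    rw [Subgroup.mem_comap, map_commutatorElement]
    exact (commutator_apply (ih hx)).1

/-- The leading coefficients of a series with vanishing Dynkin defect are reproduced by `dynkin`. -/
theorem dynkin_eq_of_vanishesUpTo {S : Set ℕ+} {f : SeriesGroup} (hf : dynkinDefect f.1 = 0)
    (hm : VanishesUpTo S m f.1) {w : Word} (hw : w.length = m + 1) (hwS : ∀ i ∈ w, i ∈ S) :
    dynkin f.1 w = (m + 1) * f.1 w := by
  have h : dynkinDefect f.1 w = 0 := congrFun hf w
  have hw₀ : w ≠ [] := List.ne_nil_of_length_pos (by omega)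
  rw [dynkinDefect, conv_eq_add_sum _ _ hw₀, dynkin_nil, f.2, Finset.sum_eq_zero, hw] at h
  · push_cast at h
    linear_combination -h
  · intro j hj
    rw [Finset.mem_Ico] at hj
    rw [hm _ _ _ (mem_of_mem_drop hwS), mul_zero]
    · exact List.ne_nil_of_length_pos (by rw [List.length_drop]; omega)
    · rw [List.length_drop]; omega

end SeriesGroup

/-! ### Paths with prescribed leading terms -/

namespace PathSpace

variable {T : ℝ}

/-- The path with the constant coefficients `cᵢ` for `i ∈ S`, the others being zero. -/
def constPath (T : ℝ) (S : Finset ℕ+) (c : ℕ+ → ℂ) : PathSpace T where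
  coeff i x := if i ∈ S ∧ x ∈ Set.Icc 0 T then c i else 0
  measurable i := by
    by_cases hi : i ∈ S
    · simp only [hi, true_and]
      exact Measurable.ite measurableSet_Icc measurable_const measurable_const
    · simp only [hi, false_and, if_false]
      exact measurable_const
  eq_zero i x hx := if_neg fun h => hx h.2
  bounded := by
    -- The summand `1` makes the base at least one, so its powers still dominate each `‖c i‖`.
    refine ⟨1 + ∑ i ∈ S, ‖c i‖, fun i x => ?_⟩
    have h₀ : 0 ≤ ∑ i ∈ S, ‖c i‖ := Finset.sum_nonneg fun _ _ => norm_nonneg _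
    split_ifs with h
    · calc ‖c i‖ ≤ ∑ i ∈ S, ‖c i‖ :=
            Finset.single_le_sum (f := fun i => ‖c i‖) (fun _ _ => norm_nonneg _) h.1
        _ ≤ 1 + ∑ i ∈ S, ‖c i‖ := by linarith
        _ ≤ _ := le_self_pow₀ (by linarith) i.pos.ne'
    · rw [norm_zero]; positivity

theorem iterInt_constPath (hT : 0 ≤ T) (S : Finset ℕ+) (c : ℕ+ → ℂ) (i : ℕ+) :
    (constPath T S c).iterInt [i] = if i ∈ S then T * c i else 0 := by
  have h : ∫ s in (0 : ℝ)..T, (constPath T S c).coeff i s * 1 =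
      ∫ _ in (0 : ℝ)..T, if i ∈ S then c i else 0 := by
    refine intervalIntegral.integral_congr fun s hs => ?_
    rw [Set.uIcc_of_le hT] at hs
    simp [constPath, hs.1, hs.2]
  change ∫ s in (0 : ℝ)..T, (constPath T S c).coeff i s * 1 = _
  rw [h, intervalIntegral.integral_const]
  split_ifs <;> simp

end PathSpace

namespace PathGroup

variable {T : ℝ} [hT : Fact (0 < T)]

theorem exists_iterInt_singleton (S : Finset ℕ+) (c : ℕ+ → ℂ) :
    ∃ g : PathGroup T, ∀ i, g.iterInt [i] = if i ∈ S then c i else 0 := by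
  refine ⟨mk (PathSpace.constPath T S fun i => c i / T), fun i => ?_⟩
  have h : (T : ℂ) ≠ 0 := Complex.ofReal_ne_zero.2 hT.out.ne'
  rw [iterInt_mk, PathSpace.iterInt_constPath hT.out.le, mul_div_cancel₀ _ h]

theorem toSeries_mem_longWords {n : ℕ} {g : PathGroup T}
    (hg : g ∈ (⊤ : Subgroup (PathGroup T)).lowerCentralSeries n) :
    g.toSeries ∈ SeriesGroup.longWords n :=
  SeriesGroup.lowerCentralSeries_le_comap_longWords toSeriesHom n hg

/-- The contribution of the letter `s` to `dynkin f`. -/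
def dynkinTerm (f : Word → ℂ) (s : ℕ+) : Word → ℂ
  | [] => 0
  | i :: v => (if i = s then dynkin (fun w => f (s :: w)) v else 0) -
      if (i :: v).getLast (List.cons_ne_nil i v) = s then
        dynkin (fun w => f (s :: w)) (i :: v).dropLast else 0

/-- For a given word only its first and last letters contribute to the sum, and both lie in `S`.
Length at least two excludes the separate one-letter term of `dynkin`. -/
theorem sum_dynkinTerm (f : Word → ℂ) (S : Finset ℕ+) {w : Word} (hw : 2 ≤ w.length)
    (hwS : ∀ i ∈ w, i ∈ S) : ∑ s ∈ S, dynkinTerm f s w = dynkin f w := by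
  match w, hw, hwS with
  | i :: v, hw, hwS =>
    have hv : v ≠ [] := List.ne_nil_of_length_pos (by simp at hw; omega)
    simp only [dynkinTerm]
    rw [Finset.sum_sub_distrib, Finset.sum_ite_eq, Finset.sum_ite_eq,
      if_pos (hwS _ (List.getLast_mem _)), if_pos (hwS _ (by simp)), dynkin_cons, if_neg hv,
      zero_add]

/-- The leading terms of commutators of paths realize `dynkin f` for every `f`. -/
theorem exists_toSeries_eq_dynkin (S : Finset ℕ+) (k : ℕ) (f : Word → ℂ) :
    ∃ h ∈ (⊤ : Subgroup (PathGroup T)).lowerCentralSeries k,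
      ∀ w : Word, w.length = k + 1 → (∀ i ∈ w, i ∈ S) → h.toSeries.1 w = dynkin f w := by
  induction k generalizing f with
  | zero =>
    obtain ⟨g, hg⟩ := exists_iterInt_singleton (T := T) S fun i => f [i]
    refine ⟨g, trivial, fun w hw hwS => ?_⟩
    obtain ⟨i, rfl⟩ := List.length_eq_one_iff.1 hw
    change g.iterInt [i] = _
    rw [hg, if_pos (hwS i (by simp)), dynkin_cons]
    simp [dynkin_nil]
  | succ k ih =>
    -- A right-normed bracket starting with `s` is `[s, L]`. The commutator with a path whose linear
    -- term is the letter `s` alone turns the leading term `L` into `s L - L s`.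
    have hs (s : ℕ+) : ∃ h ∈ (⊤ : Subgroup (PathGroup T)).lowerCentralSeries (k + 1),
        ∀ w : Word, w.length = k + 2 → (∀ i ∈ w, i ∈ S) →
          h.toSeries.1 w = dynkinTerm f s w := by
      obtain ⟨h, hh, hw⟩ := ih fun w => f (s :: w)
      obtain ⟨e, he⟩ := exists_iterInt_singleton (T := T) {s} fun _ => 1
      refine ⟨⁅h, e⁆, Subgroup.commutator_mem_commutator hh (Subgroup.mem_top e), fun w hwl hwS => ?_⟩
      have hcomm : (⁅h, e⁆).toSeries = ⁅h.toSeries, e.toSeries⁆ :=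
        map_commutatorElement toSeriesHom h e
      rw [hcomm, (SeriesGroup.commutator_apply (toSeries_mem_longWords hh)).2 w hwl]
      change e.iterInt _ * h.toSeries.1 _ - h.toSeries.1 _ * e.iterInt _ = _
      match w, hwl, hwS with
      | i :: v, hwl, hwS =>
        have hlast : (i :: v).drop (k + 1) = [(i :: v).getLast (List.cons_ne_nil i v)] := by
          have hk : k + 1 = (i :: v).length - 1 := by omega
          rw [hk, List.drop_length_sub_one]
        have hinit : (i :: v).take (k + 1) = (i :: v).dropLast := by
          rw [List.dropLast_eq_take, hwl]
          rfl
        rw [hw _ (by simp at hwl ⊢; omega) (fun j hj => hwS j (List.mem_of_mem_drop hj)),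
          hw _ (by simp at hwl ⊢; omega) (fun j hj => hwS j (List.mem_of_mem_take hj)), hlast,
          hinit]
        simp only [List.take_succ_cons, List.take_zero, List.drop_succ_cons, List.drop_zero, he,
          Finset.mem_singleton, dynkinTerm]
        split_ifs <;> simp
    -- Leading terms add under products, so the contributions of the letters can be multiplied
    -- together.
    have hsum (R : Finset ℕ+) : ∃ h ∈ (⊤ : Subgroup (PathGroup T)).lowerCentralSeries (k + 1),
        ∀ w : Word, w.length = k + 2 → (∀ i ∈ w, i ∈ S) →
          h.toSeries.1 w = ∑ s ∈ R, dynkinTerm f s w := by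
      induction R using Finset.induction_on with
      | empty =>
        refine ⟨1, one_mem _, fun w hw _ => ?_⟩
        rw [toSeries_one, Finset.sum_empty]
        cases w with
        | nil => simp at hw
        | cons i w => rfl
      | insert s R hsR ihR =>
        obtain ⟨h₁, hh₁, hw₁⟩ := hs s
        obtain ⟨h₂, hh₂, hw₂⟩ := ihR
        refine ⟨h₁ * h₂, mul_mem hh₁ hh₂, fun w hw hwS => ?_⟩
        rw [Finset.sum_insert hsR, ← hw₁ w hw hwS, ← hw₂ w hw hwS, toSeries_mul]
        exact SeriesGroup.mul_apply (toSeries_mem_longWords hh₁) (toSeries_mem_longWords hh₂)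
          (List.ne_nil_of_length_pos (by omega)) (by omega) fun _ _ => trivial
    obtain ⟨h, hh, hw⟩ := hsum S
    exact ⟨h, hh, fun w hwl hwS => by
      rw [hw w hwl hwS, sum_dynkinTerm f S (by omega) hwS]⟩

/-! ### Approximation by the lower central series -/

/-- Each coefficient of the defect is continuous in the series, so the identity for paths survives
limits. -/
theorem dynkinDefect_of_mem_closure {g : SeriesGroup}
    (hg : g ∈ (toSeriesHom (T := T)).range.topologicalClosure) : dynkinDefect g.1 = 0 := by
  have hc : IsClosed {g : SeriesGroup | dynkinDefect g.1 = 0} := by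
    refine isClosed_eq (continuous_pi fun u => ?_) continuous_const
    refine (continuous_const.mul (SeriesGroup.continuous_coeff u)).sub (continuous_finsetSum _ fun j _ => ?_)
    exact ((continuous_dynkin _).comp SeriesGroup.continuous_val).mul
      (SeriesGroup.continuous_coeff _)
  refine closure_minimal ?_ hc hg
  rintro _ ⟨h, rfl⟩
  induction h using Quotient.inductionOn with
  | h a => exact funext fun u => PathSpace.dynkinDefect_iterInt a u

/-- An element of the closure of `G(X)` without words of length at most `n` agrees with an element
of the `n`-th term of the lower central series of `G(X)` on any finite set of words. -/
theorem exists_mem_lowerCentralSeries_eq {n : ℕ} {g : SeriesGroup}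
    (hg : g ∈ (toSeriesHom (T := T)).range.topologicalClosure)
    (hgn : g ∈ SeriesGroup.longWords n) (S : Finset ℕ+) {N : ℕ} (hN : n ≤ N) :
    ∃ h ∈ (⊤ : Subgroup (PathGroup T)).lowerCentralSeries n,
      ∀ w : Word, w ≠ [] → w.length ≤ N → (∀ i ∈ w, i ∈ (S : Set ℕ+)) →
        g.1 w = h.toSeries.1 w := by
  induction N, hN using Nat.le_induction with
  | base =>
    refine ⟨1, one_mem _, fun w hw₀ hw _ => ?_⟩
    rw [SeriesGroup.mem_longWords.1 hgn w hw₀ hw, toSeries_one]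
    cases w with
    | nil => exact absurd rfl hw₀
    | cons i w => rfl
  | succ N hN ih =>
    obtain ⟨h, hh, hgh⟩ := ih
    obtain ⟨hr, hr'⟩ := SeriesGroup.mul_inv_apply hgh
    set r : SeriesGroup := g * h.toSeries⁻¹ with hrdef
    have hrc : r ∈ (toSeriesHom (T := T)).range.topologicalClosure :=
      mul_mem hg (inv_mem (Subgroup.le_topologicalClosure _ ⟨h, rfl⟩))
    -- The factor `(N + 1)⁻¹` undoes the eigenvalue `N + 1` of the bracketing on the leading term of
    -- `r`, so `c` has the same leading term as `r` on words over `S`.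
    obtain ⟨c, hc, hc'⟩ := exists_toSeries_eq_dynkin (T := T) S N
      fun w => ((N : ℂ) + 1)⁻¹ * r.1 w
    have hcN : VanishesUpTo (S : Set ℕ+) N c.toSeries.1 :=
      fun w hw₀ hw _ => SeriesGroup.mem_longWords.1 (toSeries_mem_longWords hc) w hw₀ hw
    refine ⟨c * h, mul_mem (Subgroup.lowerCentralSeries_antitone _ hN hc) hh,
      fun w hw₀ hw hwS => ?_⟩
    rw [toSeries_mul, SeriesGroup.coe_mul, conv_eq_add h.toSeries.2 c.toSeries.2
      (vanishesUpTo_zero _) hcN hw₀ (by omega) hwS]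
    rcases hw.lt_or_eq with hlt | heq
    · rw [hcN w hw₀ (by omega) hwS, hgh w hw₀ (by omega) hwS, add_zero]
    · rw [hc' w heq hwS, dynkin_const_mul, SeriesGroup.dynkin_eq_of_vanishesUpTo
        (dynkinDefect_of_mem_closure hrc) hr heq hwS, inv_mul_cancel_left₀
        (Nat.cast_add_one_ne_zero N), hr' w hw₀ hw hwS]
      ring

theorem mem_closure_lowerCentralSeries {n : ℕ} {g : SeriesGroup}
    (hg : g ∈ (toSeriesHom (T := T)).range.topologicalClosure)
    (hgn : g ∈ SeriesGroup.longWords n) :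
    g ∈ closure (toSeries '' ((⊤ : Subgroup (PathGroup T)).lowerCentralSeries n : Set (PathGroup T))) := by
  -- Alphabet and length bound grow together; a word is covered once `N` exceeds its length and its
  -- weight, since no letter exceeds the weight.
  have hex (N : ℕ) := exists_mem_lowerCentralSeries_eq hg hgn (Finset.Icc 1 N.succPNat)
    (Nat.le_add_right n N)
  choose h hh hw using hex
  refine mem_closure_of_tendsto (f := fun N => (h N).toSeries) (b := Filter.atTop) ?_
    (Filter.Eventually.of_forall fun N => ⟨h N, hh N, rfl⟩)
  refine tendsto_subtype_rng.2 (tendsto_pi_nhds.2 fun w => ?_)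
  refine tendsto_const_nhds.congr' ?_
  filter_upwards [Filter.eventually_ge_atTop (w.length + weight w)] with N hN
  by_cases hw₀ : w = []
  · rw [hw₀]
    exact g.2.trans (h N).toSeries.2.symm
  · refine hw N w hw₀ (by omega) fun i hi => ?_
    have hi' : (i : ℕ) ≤ weight w :=
      List.single_le_sum (by simp) _ (List.mem_map.2 ⟨i, hi, rfl⟩)
    rw [Finset.mem_coe, Finset.mem_Icc, ← PNat.coe_le_coe i, Nat.succPNat_coe]
    exact ⟨one_le, by omega⟩

/-- The topological lower central series of `G(X)`. -/
theorem mem_topLowerCentralSeries_iff {n : ℕ} {g : PathGroup T} :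
    g ∈ topLowerCentralSeries (PathGroup T) n ↔ g.toSeries ∈ SeriesGroup.longWords n := by
  have hc := isUniformInducing_toSeries (T := T)
  constructor
  · intro h
    exact closure_minimal (fun x hx => toSeries_mem_longWords hx)
      ((SeriesGroup.isClosed_longWords n).preimage hc.uniformContinuous.continuous) h
  · intro h
    rw [topLowerCentralSeries, hc.isInducing.closure_eq_preimage_closure_image]
    exact mem_closure_lowerCentralSeries (Subgroup.le_topologicalClosure _ ⟨g, rfl⟩) h

end PathGroup

/-! ### Passage to the completion -/

namespace FormalPathGroup

variable {T : ℝ} [hT : Fact (0 < T)]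

theorem toSeries_apply (g : FormalPathGroup T) (w : Word) : (toSeries g).1 w = iterInt w g := by
  refine isClosed_property (p := fun g => (toSeries g).1 w = iterInt w g) denseRange_ofPath
    (isClosed_eq ?_ (continuous_iterInt w)) (fun g => ?_) g
  · exact (SeriesGroup.continuous_coeff w).comp
      isUniformInducing_toSeries.uniformContinuous.continuous
  · rw [toSeries_ofPath, iterInt_ofPath]
    rfl

/-- The canonical map `G(X) → G_f(X)` as a homomorphism. -/
def ofPathHom : PathGroup T →* FormalPathGroup T := MonoidHom.mk' ofPath ofPath_mul

theorem ofPath_mem_lowerCentralSeries {n : ℕ} {g : PathGroup T}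
    (hg : g ∈ (⊤ : Subgroup (PathGroup T)).lowerCentralSeries n) :
    ofPath g ∈ (⊤ : Subgroup (FormalPathGroup T)).lowerCentralSeries n := by
  have h : ofPath g ∈ ((⊤ : Subgroup (PathGroup T)).lowerCentralSeries n).map ofPathHom :=
    ⟨g, hg, rfl⟩
  -- The image is the lower central series of the image subgroup, which is contained in that of the
  -- whole group.
  rw [Subgroup.map_lowerCentralSeries] at h
  exact Subgroup.lowerCentralSeries_mono n le_top h

/-- The topological lower central series of `G_f(X)`. -/
theorem mem_topLowerCentralSeries_iff {n : ℕ} {g : FormalPathGroup T} :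
    g ∈ topLowerCentralSeries (FormalPathGroup T) n ↔ toSeries g ∈ SeriesGroup.longWords n := by
  have hc := isUniformInducing_toSeries (T := T)
  constructor
  · intro h
    exact closure_minimal
      (fun x hx => SeriesGroup.lowerCentralSeries_le_comap_longWords toSeriesHom n hx)
      ((SeriesGroup.isClosed_longWords n).preimage hc.uniformContinuous.continuous) h
  · intro h
    rw [topLowerCentralSeries, hc.isInducing.closure_eq_preimage_closure_image]
    have hg : toSeries g ∈ (PathGroup.toSeriesHom (T := T)).range.topologicalClosure :=
      range_toSeries.subset (Set.mem_range_self g)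
    refine closure_mono ?_ (PathGroup.mem_closure_lowerCentralSeries hg h)
    rintro _ ⟨x, hx, rfl⟩
    exact ⟨ofPath x, ofPath_mem_lowerCentralSeries hx, toSeries_ofPath x⟩

end FormalPathGroup

end FormalPaths

end

theorem theorem2p17 (T : ℝ) [Fact (0 < T)] (n : ℕ) (hn : 1 ≤ n) :
    (∀ g : FormalPaths.FormalPathGroup T,
      g ∈ FormalPaths.topLowerCentralSeries (FormalPaths.FormalPathGroup T) n ↔
        ∀ w : FormalPaths.Word, 1 ≤ w.length → w.length ≤ n →
          FormalPaths.FormalPathGroup.iterInt w g = 0) ∧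
    FormalPaths.FormalPathGroup.ofPath ''
        FormalPaths.topLowerCentralSeries (FormalPaths.PathGroup T) n =
      FormalPaths.topLowerCentralSeries (FormalPaths.FormalPathGroup T) n ∩
        Set.range FormalPaths.FormalPathGroup.ofPath := by
  constructor
  · intro g
    rw [FormalPaths.FormalPathGroup.mem_topLowerCentralSeries_iff,
      FormalPaths.SeriesGroup.mem_longWords]
    simp only [FormalPaths.FormalPathGroup.toSeries_apply, Nat.one_le_iff_ne_zero, ne_eq,
      List.length_eq_zero_iff]
  · ext g
    constructor
    · rintro ⟨x, hx, rfl⟩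
      refine ⟨?_, x, rfl⟩
      rw [FormalPaths.FormalPathGroup.mem_topLowerCentralSeries_iff,
        FormalPaths.FormalPathGroup.toSeries_ofPath]
      exact FormalPaths.PathGroup.mem_topLowerCentralSeries_iff.1 hx
    -- Membership in either closed term is the same condition on the common series of `x` and
    -- `ofPath x`.
    · rintro ⟨hx, x, rfl⟩
      rw [FormalPaths.FormalPathGroup.mem_topLowerCentralSeries_iff,
        FormalPaths.FormalPathGroup.toSeries_ofPath] at hx
      exact ⟨x, FormalPaths.PathGroup.mem_topLowerCentralSeries_iff.2 hx, rfl⟩
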